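/- **Theorem (existence and uniqueness of the root of $g$).** For real $a,b,c$ put $$X(a,b,c)=\int_0^1\cos\Big(\frac a2\tau^2+b\tau+c\Big)\,d\tau,\qquad Y(a,b,c)=\int_0^1\sin\Big(\frac a2\tau^2+b\tau+c\Big)\,d\tau .$$ Let $\phi_0,\phi_1$ be real numbers with $|\phi_0|\le\phi_1\le\pi$, the case $|\phi_0|=\phi_1=\pi$ being excluded. Put $\delta=\phi_1-\phi_0$ and $$g(A)=Y(2A,\delta-A,\phi_0),\qquad h(A)=X(2A,\delta-A,\phi_0),$$ $$\theta_{\max}=\max\{0,\pi/2+\phi_0\},\qquad A_{\max}=\delta+2\theta_{\max}\Big(1+\sqrt{1+\delta/\theta_{\max}}\Big),$$ where $A_{\max}=\delta$ if $\theta_{\max}=0$. Then: 1. If $\phi_0+\phi_1\neq0$, the equation $g(A)=0$ has exactly one solution $A\in(0,A_{\max}]$. 2. If $\phi_0+\phi_1=0$, then $A=0$ is the one and only solution of $g(A)=0$ in $[0,A_{\max}]$. 3. In both cases, for every $A\in[0,A_{\max}]$ with $g(A)=0$ one has $h(A)>0$. Consequently, for every displacement $(\Delta x,\Delta y)\ne(0,0)$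 between the two end points, the clothoid length $L=\sqrt{\Delta x^2+\Delta y^2}\,/\,h(A)$ is positive. -/

import Mathlib

noncomputable section

namespace Clothoid

/-- `X(a,b,c) = ∫₀¹ cos (a/2 τ² + b τ + c) dτ`. -/
def X (a b c : ℝ) : ℝ := ∫ τ in (0 : ℝ)..1, Real.cos (a / 2 * τ ^ 2 + b * τ + c)

/-- `Y(a,b,c) = ∫₀¹ sin (a/2 τ² + b τ + c) dτ`. -/
def Y (a b c : ℝ) : ℝ := ∫ τ in (0 : ℝ)..1, Real.sin (a / 2 * τ ^ 2 + b * τ + c)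

/-- `δ = φ₁ - φ₀`. -/
def delta (φ₀ φ₁ : ℝ) : ℝ := φ₁ - φ₀

/-- `g(A) = Y(2A, δ - A, φ₀)`. -/
def g (φ₀ φ₁ A : ℝ) : ℝ := Y (2 * A) (delta φ₀ φ₁ - A) φ₀

/-- `h(A) = X(2A, δ - A, φ₀)`. -/
def h (φ₀ φ₁ A : ℝ) : ℝ := X (2 * A) (delta φ₀ φ₁ - A) φ₀

/-- The length `L = √(Δx² + Δy²) / h(A)` of the clothoid segment joining two points
with displacement `(Δx, Δy)`. -/
def length (φ₀ φ₁ Δx Δy A : ℝ) : ℝ := √(Δx ^ 2 + Δy ^ 2) / h φ₀ φ₁ A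

/-- `θ_max = max {0, π/2 + φ₀}`. -/
def thetaMax (φ₀ : ℝ) : ℝ := max 0 (Real.pi / 2 + φ₀)

/-- `A_max = δ + 2 θ_max (1 + √(1 + δ/θ_max))`. When `θ_max = 0` the value is `δ`, the limit of
the expression as `θ_max` tends to `0` from above. -/
def Amax (φ₀ φ₁ : ℝ) : ℝ :=
  delta φ₀ φ₁ +
    2 * thetaMax φ₀ * (1 + √(1 + delta φ₀ φ₁ / thetaMax φ₀))

end Clothoid

end

namespace Clothoid

open Real Set Filter Topology MeasureTheory intervalIntegral

/-! Write `f(t) = A t² + (δ - A) t + φ₀` for the phase. It has the values `φ₀` at `0` and `φ₁` at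
`1` for every `A`, so `A` only bends it between fixed ends, and `g'(A) = -∫ t (1 - t) cos f`. The
heart of the proof is that `g' < 0` at every root in `[0, Amax]` (`pos_at_root`): a function that
crosses zero only downwards has at most one zero. Existence comes from `g(0) ≥ 0 ≥ g(Amax)`.

At a root with `A ≤ δ` the phase is nondecreasing. Integration by parts against `1/f'` turns `∫ t (1
- t) cos f` into `-∫ k sin f` with `k` decreasing; since `∫ sin f = 0`, `k` may be shifted to vanish
where `f` does, which gives the integral a sign. For `A > δ` the phase has an interior vertex, and
`A ≤ Amax` keeps its minimum `m` at or above `-π/2`. Then `sin f > sin m` off the vertex, and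
integrating by parts with `sin f - sin m` on each side of it gives the sign.

Positivity of `h` uses the same device (`integral_cos_sub_pos`). The sign of `g(Amax)` rests on a
comparison of the negative and positive lobes of the sine (`integral_sin_sub_nonpos`). -/

theorem hasDerivAt_quadratic (A B φ t : ℝ) :
    HasDerivAt (fun t : ℝ => A * t ^ 2 + B * t + φ) (2 * A * t + B) t := by
  have h := (((hasDerivAt_id t).pow 2).const_mul A).add ((hasDerivAt_id t).const_mul B)
  refine (h.add_const φ).congr_deriv ?_
  simp
  ring

theorem integral_pos_of_pos_off_point {f : ℝ → ℝ} {a b : ℝ} (c : ℝ) (hab : a < b)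
    (hf : ContinuousOn f (Icc a b)) (hpos : ∀ t ∈ Ioo a b, t ≠ c → 0 < f t) :
    0 < ∫ t in a..b, f t := by
  have hi : IntervalIntegrable f volume a b := hf.intervalIntegrable_of_Icc hab.le
  by_cases hc : c ∈ Ioo a b
  · have h1 : IntervalIntegrable f volume a c :=
      (hf.mono (Icc_subset_Icc_right hc.2.le)).intervalIntegrable_of_Icc hc.1.le
    have h2 : IntervalIntegrable f volume c b :=
      (hf.mono (Icc_subset_Icc_left hc.1.le)).intervalIntegrable_of_Icc hc.2.le
    rw [← integral_add_adjacent_intervals h1 h2]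
    exact add_pos
      (intervalIntegral_pos_of_pos_on h1
        (fun t ht => hpos t ⟨ht.1, ht.2.trans hc.2⟩ ht.2.ne) hc.1)
      (intervalIntegral_pos_of_pos_on h2
        (fun t ht => hpos t ⟨hc.1.trans ht.1, ht.2⟩ ht.1.ne') hc.2)
  · exact intervalIntegral_pos_of_pos_on hi
      (fun t ht => hpos t ht fun h => hc (h ▸ ht)) hab

/-! ### Cosine integrals of convex phases -/

/-- The integral of `cos (f - α)` along an increasing convex quadratic phase `f` is positive if
`cos (· - α)` is nonnegative between the initial phase and the mean of the extreme phases. -/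
theorem integral_cos_sub_pos {A B φ α : ℝ} (hA : 0 ≤ A) (hB : 0 ≤ B) (hAB : 0 < A + B)
    (h2π : A + B < 2 * π) (hl : -(π / 2) ≤ φ - α) (hr : φ + (A + B) / 2 - α < π / 2) :
    0 < ∫ t in (0 : ℝ)..1, cos (A * t ^ 2 + B * t + φ - α) := by
  set f : ℝ → ℝ := fun t => A * t ^ 2 + B * t + φ with hf
  -- The increment of the sine divided by `f'`. As `f'` is nondecreasing, `Φ' ≤ cos (f - α)`, so the
  -- integral is at least `Φ 1 - Φ 0`. For `B = 0` the value `0 / 0 = 0` at the origin agrees with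
  -- the limit.
  set Φ : ℝ → ℝ := fun t => (sin (f t - α) - sin (φ - α)) / (2 * A * t + B) with hΦ
  have hden : ∀ t : ℝ, 0 < t → 0 < 2 * A * t + B := by
    intro t ht
    rcases hA.eq_or_lt with h | h
    · subst h; linarith
    · positivity
  have hdiff : ∀ t : ℝ, 0 ≤ t → t ≤ 1 → 0 ≤ f t - φ ∧ f t - φ ≤ A + B := by
    intro t h0 h1
    simp only [hf]
    constructor
    · have : 0 ≤ A * t ^ 2 + B * t := by positivity
      linarith
    · nlinarith [mul_le_mul_of_nonneg_left (show t ^ 2 ≤ 1 by nlinarith) hA]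
  have hnum : ∀ t : ℝ, 0 ≤ t → t ≤ 1 → 0 ≤ sin (f t - α) - sin (φ - α) := by
    intro t h0 h1
    obtain ⟨h2, h3⟩ := hdiff t h0 h1
    rw [sin_sub_sin]
    refine mul_nonneg (mul_nonneg zero_le_two (sin_nonneg_of_nonneg_of_le_pi ?_ ?_))
      (cos_nonneg_of_neg_pi_div_two_le_of_le ?_ ?_) <;> linarith
  have hderiv : ∀ t ∈ Ioo (0 : ℝ) 1, HasDerivAt Φ
      ((cos (f t - α) * (2 * A * t + B) * (2 * A * t + B) -
        (sin (f t - α) - sin (φ - α)) * (2 * A)) / (2 * A * t + B) ^ 2) t := by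
    intro t ht
    have h1 := (((hasDerivAt_quadratic A B φ t).sub_const α).sin).sub_const (sin (φ - α))
    have h2 : HasDerivAt (fun t : ℝ => 2 * A * t + B) (2 * A) t := by
      simpa using ((hasDerivAt_id t).const_mul (2 * A)).add_const B
    exact h1.div h2 (hden t ht.1).ne'
  have hΦ0 : Φ 0 = 0 := by simp [hΦ, hf]
  have hbound : ∀ t ∈ Icc (0 : ℝ) 1, ‖Φ t‖ ≤ t := by
    intro t ht
    rcases ht.1.eq_or_lt with h | h
    · rw [← h, hΦ0]; simp
    · obtain ⟨h2, h3⟩ := hdiff t ht.1 ht.2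
      rw [norm_eq_abs, abs_of_nonneg (div_nonneg (hnum t ht.1 ht.2) (hden t h).le),
        div_le_iff₀ (hden t h)]
      have h4 : sin (f t - α) - sin (φ - α) ≤ f t - φ := by
        have h5 := abs_sin_sub_sin_le (f t - α) (φ - α)
        have h6 : f t - α - (φ - α) = f t - φ := by ring
        rw [h6, abs_of_nonneg h2] at h5
        exact (le_abs_self _).trans h5
      refine h4.trans ?_
      simp only [hf]
      nlinarith [mul_nonneg hA (sq_nonneg t)]
  have hcont : ContinuousOn Φ (Icc 0 1) := by
    intro t ht
    rcases ht.1.eq_or_lt with h | h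
    · subst h
      rw [ContinuousWithinAt, hΦ0]
      refine squeeze_zero_norm' (eventually_nhdsWithin_of_forall hbound) ?_
      exact (continuous_id.tendsto (0 : ℝ)).mono_left nhdsWithin_le_nhds
    · refine ContinuousAt.continuousWithinAt ?_
      refine ContinuousAt.div ?_ ?_ (hden t h).ne'
      · simp only [hf]; fun_prop
      · fun_prop
  have hle := sub_le_integral_of_hasDeriv_right_of_le (φ := fun t => cos (f t - α))
    zero_le_one hcont (fun t ht => (hderiv t ht).hasDerivWithinAt)
    (Continuous.integrableOn_Icc (by simp only [hf]; fun_prop)) (by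
      intro t ht
      have hd := hden t ht.1
      rw [div_le_iff₀ (by positivity)]
      have := mul_nonneg (hnum t ht.1.le ht.2.le) (mul_nonneg zero_le_two hA)
      nlinarith)
  refine lt_of_lt_of_le ?_ hle
  rw [hΦ0, sub_zero]
  refine div_pos ?_ (hden 1 one_pos)
  have hf1 : f 1 = A + B + φ := by simp [hf]
  rw [hf1, sin_sub_sin]
  refine mul_pos (mul_pos two_pos (sin_pos_of_pos_of_lt_pi ?_ ?_))
    (cos_pos_of_mem_Ioo ⟨?_, ?_⟩) <;> linarith

/-- If an increasing convex quadratic phase with positive slope passes through `0` and the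
integral of its sine vanishes, the integral of `t (1 - t)` times its cosine is positive. -/
theorem integral_mul_cos_pos_of_slope_pos {A B φ : ℝ} (hA : 0 ≤ A) (hB : 0 < B)
    (hφ : φ < 0) (hφ' : -π < φ) (h1 : 0 < A + B + φ) (h1' : A + B + φ ≤ π)
    (hs : ∫ t in (0 : ℝ)..1, sin (A * t ^ 2 + B * t + φ) = 0) :
    0 < ∫ t in (0 : ℝ)..1, t * (1 - t) * cos (A * t ^ 2 + B * t + φ) := by
  set f : ℝ → ℝ := fun t => A * t ^ 2 + B * t + φ with hf
  have hfc : Continuous f := by simp only [hf]; fun_prop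
  have hmono : ∀ s t : ℝ, 0 ≤ s → s < t → f s < f t := by
    intro s t h0 hst
    have : 0 ≤ A * ((t - s) * (t + s)) := by
      refine mul_nonneg hA (mul_nonneg ?_ ?_) <;> linarith
    have := mul_pos hB (sub_pos.2 hst)
    simp only [hf]
    nlinarith
  have hf0 : f 0 = φ := by simp [hf]
  have hf1 : f 1 = A + B + φ := by simp [hf]
  obtain ⟨c, hc, hfcz⟩ : (0 : ℝ) ∈ f '' Ioo 0 1 :=
    intermediate_value_Ioo zero_le_one hfc.continuousOn ⟨by rw [hf0]; exact hφ, by rw [hf1]; exact h1⟩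
  have hden : ∀ t : ℝ, 0 ≤ t → 0 < 2 * A * t + B := fun t ht => by positivity
  -- `k` is the derivative of `t (1 - t) / f'`.
  set k : ℝ → ℝ := fun t => (B - 2 * B * t - 2 * A * t ^ 2) / (2 * A * t + B) ^ 2 with hk
  have hkanti : ∀ s t : ℝ, 0 ≤ s → s < t → k t < k s := by
    intro s t h0 hst
    have hs' := hden s h0
    have ht' := hden t (h0.trans hst.le)
    have : k s - k t = (B ^ 2 + 2 * A * B) * (t - s) * ((2 * A * s + B) + (2 * A * t + B)) /
        ((2 * A * s + B) ^ 2 * (2 * A * t + B) ^ 2) := by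
      simp only [hk]
      rw [div_sub_div _ _ (by positivity) (by positivity)]
      congr 1
      ring
    have hpos : 0 < k s - k t := by
      rw [this]
      have := sub_pos.2 hst
      positivity
    linarith
  have hkc : ContinuousOn k (Icc 0 1) := by
    refine ContinuousOn.div (by fun_prop) (by fun_prop) fun t ht => ?_
    have := hden t ht.1
    positivity
  have hderiv : ∀ t ∈ Ioo (0 : ℝ) 1,
      HasDerivAt (fun t => t * (1 - t) / (2 * A * t + B) * sin (f t))
        (k t * sin (f t) + t * (1 - t) * cos (f t)) t := by
    intro t ht
    have hd := hden t ht.1.le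
    have e1 : HasDerivAt (fun t : ℝ => 2 * A * t + B) (2 * A) t := by
      simpa using ((hasDerivAt_id t).const_mul (2 * A)).add_const B
    have e2 : HasDerivAt (fun t : ℝ => t * (1 - t)) (1 - 2 * t) t := by
      refine ((hasDerivAt_id t).mul ((hasDerivAt_id t).const_sub 1)).congr_deriv ?_
      simp; ring
    refine ((e2.div e1 hd.ne').mul (hasDerivAt_quadratic A B φ t).sin).congr_deriv ?_
    have hd' := hd.ne'
    have hkt : k t =
        ((1 - 2 * t) * (2 * A * t + B) - t * (1 - t) * (2 * A)) / (2 * A * t + B) ^ 2 := by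
      simp only [hk]
      congr 1
      ring
    rw [hkt]
    simp only [Pi.div_apply, hf]
    generalize 2 * A * t + B = d at hd' ⊢
    field_simp
  have i1 : IntervalIntegrable (fun t => k t * sin (f t) + t * (1 - t) * cos (f t)) volume 0 1 := by
    refine ContinuousOn.intervalIntegrable ?_
    rw [uIcc_of_le zero_le_one]
    fun_prop
  have i2 : IntervalIntegrable (fun t => (k c - k t) * sin (f t)) volume 0 1 := by
    refine ContinuousOn.intervalIntegrable ?_
    rw [uIcc_of_le zero_le_one]
    fun_prop
  have i3 : IntervalIntegrable (fun t => k c * sin (f t)) volume 0 1 :=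
    Continuous.intervalIntegrable (by fun_prop) _ _
  have I1 : ∫ t in (0 : ℝ)..1, (k t * sin (f t) + t * (1 - t) * cos (f t)) = 0 := by
    rw [integral_eq_sub_of_hasDerivAt_of_le zero_le_one ?_ hderiv i1]
    · simp
    · refine ContinuousOn.mul (ContinuousOn.div (by fun_prop) (by fun_prop) ?_) (by fun_prop)
      exact fun t ht => (hden t ht.1).ne'
  -- Both factors change sign exactly at the zero `c` of `f`. Adding `k c * sin f` is free because
  -- the sine integral vanishes.
  have I2 : 0 < ∫ t in (0 : ℝ)..1, (k c - k t) * sin (f t) := by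
    refine integral_pos_of_pos_off_point c zero_lt_one (by fun_prop) fun t ht htc => ?_
    rcases lt_or_gt_of_ne htc with h | h
    · have h2 := hmono t c ht.1.le h
      have h3 := hmono 0 t le_rfl ht.1
      exact mul_pos_of_neg_of_neg (sub_neg.2 (hkanti t c ht.1.le h))
        (sin_neg_of_neg_of_neg_pi_lt (hfcz ▸ h2) (by linarith))
    · have h2 := hmono c t hc.1.le h
      have h4 := hmono t 1 ht.1.le ht.2
      exact mul_pos (sub_pos.2 (hkanti c t hc.1.le h))
        (sin_pos_of_pos_of_lt_pi (hfcz ▸ h2) (by linarith))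
  have : ∫ t in (0 : ℝ)..1, t * (1 - t) * cos (f t) =
      (∫ t in (0 : ℝ)..1, (k c - k t) * sin (f t)) +
      (∫ t in (0 : ℝ)..1, (k t * sin (f t) + t * (1 - t) * cos (f t))) -
      ∫ t in (0 : ℝ)..1, k c * sin (f t) := by
    rw [← integral_add i2 i1, ← integral_sub (i2.add i1) i3]
    congr 1
    ext t
    ring
  rw [this, I1, intervalIntegral.integral_const_mul, hs]
  simpa using I2

/-- The analogue of `integral_mul_cos_pos_of_slope_pos` for a phase that is stationary at `0`. -/
theorem integral_mul_cos_pos_of_slope_zero {A φ : ℝ} (hA : 0 < A) (hφ : φ < 0) (hφ' : -π < φ)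
    (hs : ∫ t in (0 : ℝ)..1, sin (A * t ^ 2 + 0 * t + φ) = 0) :
    0 < ∫ t in (0 : ℝ)..1, t * (1 - t) * cos (A * t ^ 2 + 0 * t + φ) := by
  -- Here `f' = 2 A t` supplies the factor `t` of the weight, and the boundary term is `-sin φ > 0`.
  have hderiv : ∀ t ∈ uIcc (0 : ℝ) 1,
      HasDerivAt (fun t => (1 - t) * sin (A * t ^ 2 + 0 * t + φ))
        (2 * A * (t * (1 - t) * cos (A * t ^ 2 + 0 * t + φ)) - sin (A * t ^ 2 + 0 * t + φ)) t := by
    intro t _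
    refine (((hasDerivAt_id t).const_sub 1).mul (hasDerivAt_quadratic A 0 φ t).sin).congr_deriv ?_
    simp
    ring
  have h := integral_eq_sub_of_hasDerivAt hderiv (Continuous.intervalIntegrable (by fun_prop) _ _)
  rw [intervalIntegral.integral_sub (Continuous.intervalIntegrable (by fun_prop) _ _)
    (Continuous.intervalIntegrable (by fun_prop) _ _), hs, intervalIntegral.integral_const_mul] at h
  have hsin := sin_neg_of_neg_of_neg_pi_lt hφ hφ'
  simp only [sub_self, zero_mul, sub_zero, one_mul, zero_sub] at h
  norm_num at h
  norm_num
  nlinarith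

/-- Right of its vertex `s ≥ 0`, a convex quadratic phase whose minimum lies in `[-π/2, 0]` gives
a positive integral of `t (1 - t)` times its cosine. -/
theorem integral_mul_cos_pos_of_vertex {A m s : ℝ} (hA : 0 < A) (hm : -(π / 2) ≤ m) (hm0 : m ≤ 0)
    (hs0 : 0 ≤ s) (hs1 : s < 1) (hπ : A * (1 - s) ^ 2 + m ≤ π) :
    0 < ∫ t in s..1, t * (1 - t) * cos (A * (t - s) ^ 2 + m) := by
  set f : ℝ → ℝ := fun t => A * (t - s) ^ 2 + m with hf
  -- Subtracting `sin m` cancels the pole of `1/f'` at the vertex, so `Φ` vanishes at both ends.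
  set Φ : ℝ → ℝ := fun t => t * (1 - t) / (2 * A * (t - s)) * (sin (f t) - sin m) with hΦ
  have hfm : ∀ t ∈ Ioo s 1, m < f t ∧ f t < π := by
    intro t ht
    have h1 : 0 < t - s := sub_pos.2 ht.1
    have h2 : (t - s) ^ 2 < (1 - s) ^ 2 := by nlinarith [ht.2]
    have h3 := mul_lt_mul_of_pos_left h2 hA
    have h4 : 0 < A * (t - s) ^ 2 := by positivity
    constructor
    · simp only [hf]; linarith
    · simp only [hf]; linarith
  have hnum : ∀ t ∈ Ioo s 1, 0 < sin (f t) - sin m := by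
    intro t ht
    obtain ⟨h1, h2⟩ := hfm t ht
    rw [sin_sub_sin]
    refine mul_pos (mul_pos two_pos (sin_pos_of_pos_of_lt_pi ?_ ?_))
      (cos_pos_of_mem_Ioo ⟨?_, ?_⟩) <;> linarith [pi_pos]
  have hderiv : ∀ t ∈ Ioo s 1, HasDerivAt Φ
      ((-(t - s) ^ 2 + s ^ 2 - s) / (2 * A * (t - s) ^ 2) * (sin (f t) - sin m)
        + t * (1 - t) * cos (f t)) t := by
    intro t ht
    have hd : 0 < t - s := sub_pos.2 ht.1
    have e1 : HasDerivAt (fun t : ℝ => 2 * A * (t - s)) (2 * A) t := by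
      simpa using ((hasDerivAt_id t).sub_const s).const_mul (2 * A)
    have e2 : HasDerivAt (fun t : ℝ => t * (1 - t)) (1 - 2 * t) t := by
      refine ((hasDerivAt_id t).mul ((hasDerivAt_id t).const_sub 1)).congr_deriv ?_
      simp; ring
    have e3 : HasDerivAt f (2 * A * (t - s)) t := by
      refine (((((hasDerivAt_id t).sub_const s).pow 2).const_mul A).add_const m).congr_deriv ?_
      simp; ring
    refine ((e2.div e1 (by positivity)).mul (e3.sin.sub_const (sin m))).congr_deriv ?_
    simp only [Pi.div_apply]
    field_simp
    ring
  have hΦs : Φ s = 0 := by simp [hΦ]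
  have hbound : ∀ t ∈ Icc s 1, ‖Φ t‖ ≤ t - s := by
    intro t ht
    rcases ht.1.eq_or_lt with h | h
    · rw [← h, hΦs]; simp
    · have hd : 0 < t - s := sub_pos.2 h
      have h0 : 0 ≤ t := hs0.trans ht.1
      have h4 : |sin (f t) - sin m| ≤ A * (t - s) ^ 2 := by
        have h5 := abs_sin_sub_sin_le (f t) m
        have h6 : f t - m = A * (t - s) ^ 2 := by simp [hf]
        rwa [h6, abs_of_nonneg (a := A * (t - s) ^ 2) (by positivity)] at h5
      have h7 : 0 ≤ t * (1 - t) := mul_nonneg h0 (sub_nonneg.2 ht.2)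
      have h8 : t * (1 - t) ≤ 2 := by nlinarith [ht.2]
      rw [norm_eq_abs, hΦ]
      simp only [abs_mul]
      rw [abs_of_nonneg (div_nonneg h7 (by positivity)), div_mul_eq_mul_div,
        div_le_iff₀ (by positivity)]
      calc t * (1 - t) * |sin (f t) - sin m| ≤ 2 * (A * (t - s) ^ 2) := by gcongr
        _ = (t - s) * (2 * A * (t - s)) := by ring
  have hcont : ContinuousOn Φ (Icc s 1) := by
    intro t ht
    rcases ht.1.eq_or_lt with h | h
    · subst h
      rw [ContinuousWithinAt, hΦs]
      refine squeeze_zero_norm' (eventually_nhdsWithin_of_forall hbound) ?_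
      have : Tendsto (fun t : ℝ => t - s) (𝓝 s) (𝓝 (s - s)) :=
        (continuous_id.sub continuous_const).tendsto s
      rw [sub_self] at this
      exact this.mono_left nhdsWithin_le_nhds
    · have hd : 0 < t - s := sub_pos.2 h
      refine ContinuousAt.continuousWithinAt (ContinuousAt.mul ?_ ?_)
      · refine ContinuousAt.div (by fun_prop) (by fun_prop) ?_
        positivity
      · simp only [hf]; fun_prop
  have hle := sub_le_integral_of_hasDeriv_right_of_le
    (φ := fun t => t * (1 - t) * cos (f t) - 1 / (2 * A) * (sin (f t) - sin m))
    hs1.le hcont (fun t ht => (hderiv t ht).hasDerivWithinAt)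
    (Continuous.integrableOn_Icc (by simp only [hf]; fun_prop)) (by
      intro t ht
      have hd : 0 < t - s := sub_pos.2 ht.1
      -- Uses `s² ≤ s`.
      have hq : (-(t - s) ^ 2 + s ^ 2 - s) / (2 * A * (t - s) ^ 2) ≤ -(1 / (2 * A)) := by
        rw [div_le_iff₀ (by positivity)]
        have : -(1 / (2 * A)) * (2 * A * (t - s) ^ 2) = -(t - s) ^ 2 := by field_simp
        rw [this]
        nlinarith
      have := mul_le_mul_of_nonneg_right hq (hnum t ht).le
      linarith)
  have hpos : 0 < ∫ t in s..1, (sin (f t) - sin m) :=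
    intervalIntegral_pos_of_pos_on
      (Continuous.intervalIntegrable (by simp only [hf]; fun_prop) _ _) hnum hs1
  rw [hΦs, intervalIntegral.integral_sub
    (Continuous.intervalIntegrable (by simp only [hf]; fun_prop) _ _)
    (Continuous.intervalIntegrable (by simp only [hf]; fun_prop) _ _),
    intervalIntegral.integral_const_mul] at hle
  have hΦ1 : Φ 1 = 0 := by simp [hΦ]
  rw [hΦ1] at hle
  have := mul_pos (show 0 < 1 / (2 * A) by positivity) hpos
  linarith

/-! ### Sign of the sine integral of a pure square phase -/

theorem integral_comp_vertex {F : ℝ → ℝ} (hF : Continuous F) (A s : ℝ) :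
    ∫ t in (0 : ℝ)..1, F (A * (t - s) ^ 2) =
      s * (∫ x in (0 : ℝ)..1, F (A * s ^ 2 * x ^ 2)) +
      (1 - s) * ∫ x in (0 : ℝ)..1, F (A * (1 - s) ^ 2 * x ^ 2) := by
  have h1 := smul_integral_comp_sub_mul (a := 0) (b := 1) (fun t => F (A * (t - s) ^ 2)) s s
  have h2 := smul_integral_comp_mul_add (a := 0) (b := 1) (fun t => F (A * (t - s) ^ 2)) (1 - s) s
  simp only [smul_eq_mul, mul_one, mul_zero, sub_self, sub_zero, zero_add, sub_add_cancel] at h1 h2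
  rw [← integral_add_adjacent_intervals (b := s)
    (Continuous.intervalIntegrable (by fun_prop) _ _)
    (Continuous.intervalIntegrable (by fun_prop) _ _), ← h1, ← h2]
  congr 3
  · ext x; congr 1; ring
  · ext x; congr 1; ring

theorem sin_ge_mul_pi_sub_div_pi {z : ℝ} (h0 : 0 ≤ z) (h1 : z ≤ π) : z * (π - z) / π ≤ sin z := by
  have key : ∀ w : ℝ, 0 ≤ w → w ≤ π / 2 → w * (π - w) / π ≤ sin w := by
    intro w hw hw'
    refine le_trans ?_ (sin_ge_sub_cube hw)
    rw [div_le_iff₀ pi_pos]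
    have h2 : π * w ≤ 6 := by nlinarith [pi_lt_d2, pi_pos]
    nlinarith [mul_nonneg (sq_nonneg w) (sub_nonneg.2 h2)]
  rcases le_total z (π / 2) with h | h
  · exact key z h0 h
  · have := key (π - z) (by linarith) (by linarith)
    rw [sin_pi_sub] at this
    convert this using 2
    ring

/-- Lower bound for the negative lobe in `integral_sin_sub_nonpos`, obtained by integrating
polynomial minorants of the sine. -/
theorem one_le_mul_integral_sin {c : ℝ} (h1 : π / 2 ≤ c) (h2 : c ≤ π) :
    1 ≤ c * ∫ x in (0 : ℝ)..1, sin (c - c * x ^ 2) := by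
  have hπ := pi_gt_d2
  have hπ' := pi_lt_d2
  have hz : ∀ x ∈ Icc (0 : ℝ) 1, 0 ≤ c - c * x ^ 2 ∧ c - c * x ^ 2 ≤ c := by
    intro x hx
    have : x ^ 2 ≤ 1 := by nlinarith [hx.1, hx.2]
    constructor <;> nlinarith [sq_nonneg x]
  have hlow : ∀ P : ℝ → ℝ, Continuous P → (∀ z, 0 ≤ z → z ≤ c → P z ≤ sin z) →
      ∫ x in (0 : ℝ)..1, P (c - c * x ^ 2) ≤ ∫ x in (0 : ℝ)..1, sin (c - c * x ^ 2) := by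
    intro P hP hle
    refine integral_mono_on zero_le_one (Continuous.intervalIntegrable (by fun_prop) _ _)
      (Continuous.intervalIntegrable (by fun_prop) _ _) fun x hx => ?_
    exact hle _ (hz x hx).1 (hz x hx).2
  have mono : ∀ n : ℕ, ∀ x : ℝ, HasDerivAt (fun x : ℝ => x ^ (n + 1)) ((n + 1) * x ^ n) x := by
    intro n x
    simpa using hasDerivAt_pow (n + 1) x
  -- Neither minorant covers the whole range: the parabola yields only `π²/10 < 1` at `c = π/2`, and
  -- the cubic a negative value at `c = π`.
  rcases le_total c 2 with h | h
  · have := hlow (fun z => z - z ^ 3 / 6) (by fun_prop) fun z hz _ => sin_ge_sub_cube hz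
    have hval : ∫ x in (0 : ℝ)..1, (c - c * x ^ 2 - (c - c * x ^ 2) ^ 3 / 6) =
        c * (2 / 3) - c ^ 3 / 6 * (16 / 35) := by
      rw [integral_eq_sub_of_hasDerivAt (f := fun x => c * (x ^ (0 + 1) - x ^ (2 + 1) / 3) -
        c ^ 3 / 6 * (x ^ (0 + 1) - x ^ (2 + 1) + x ^ (4 + 1) * (3 / 5) - x ^ (6 + 1) / 7))
        ?_ (Continuous.intervalIntegrable (by fun_prop) _ _)]
      · norm_num
      · intro x _
        refine ((((mono 0 x).sub ((mono 2 x).div_const 3)).const_mul c).sub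
          (((((mono 0 x).sub (mono 2 x)).add ((mono 4 x).mul_const (3 / 5))).sub
            ((mono 6 x).div_const 7)).const_mul (c ^ 3 / 6))).congr_deriv ?_
        push_cast
        ring
    rw [hval] at this
    have hc : 1.57 ≤ c := by linarith
    have h3 := mul_le_mul_of_nonneg_left this (by linarith : (0 : ℝ) ≤ c)
    have h4 : 2.46 ≤ c ^ 2 := by nlinarith
    have h5 : c ^ 2 ≤ 4 := by nlinarith
    nlinarith [mul_nonneg (sub_nonneg.2 h4) (sub_nonneg.2 h5)]
  · have := hlow (fun z => z * (π - z) / π) (by fun_prop)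
      fun z hz hzc => sin_ge_mul_pi_sub_div_pi hz (hzc.trans h2)
    have hval : ∫ x in (0 : ℝ)..1, (c - c * x ^ 2) * (π - (c - c * x ^ 2)) / π =
        c * (2 / 3) - c ^ 2 / π * (8 / 15) := by
      rw [integral_eq_sub_of_hasDerivAt (f := fun x => c * (x ^ (0 + 1) - x ^ (2 + 1) / 3) -
        c ^ 2 / π * (x ^ (0 + 1) - x ^ (2 + 1) * (2 / 3) + x ^ (4 + 1) / 5))
        ?_ (Continuous.intervalIntegrable (by fun_prop) _ _)]
      · norm_num
      · intro x _
        refine ((((mono 0 x).sub ((mono 2 x).div_const 3)).const_mul c).sub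
          ((((mono 0 x).sub ((mono 2 x).mul_const (2 / 3))).add
            ((mono 4 x).div_const 5)).const_mul (c ^ 2 / π))).congr_deriv ?_
        push_cast
        field_simp
        ring
    rw [hval] at this
    have h3 := mul_le_mul_of_nonneg_left this (by linarith : (0 : ℝ) ≤ c)
    -- `50 / 157 = 1 / 3.14`.
    have h4 : c ^ 2 / π ≤ c ^ 2 * (50 / 157) := by
      rw [div_le_iff₀ pi_pos]
      nlinarith [sq_nonneg c]
    have h5 := mul_le_mul_of_nonneg_left h4 (by linarith : (0 : ℝ) ≤ c)
    have h6 : 0 ≤ (c - 2) * (3.15 - c) := mul_nonneg (by linarith) (by linarith)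
    have h7 := mul_nonneg h6 (by linarith : (0 : ℝ) ≤ c)
    nlinarith

/-- If the phase crosses zero at `r`, so that `D r² = c`, the part before `r` rescales to `-r S`
with `c S ≥ 1`. After `r` the slope is at least `2 D r`, so that part is at most `(1 - cos (D - c))
/ (2 D r) ≤ 1 / (D r) ≤ r S`. -/
theorem integral_sin_sub_nonpos {c D : ℝ} (h1 : π / 2 ≤ c) (h2 : c ≤ π) (hD : 0 ≤ D)
    (hDc : D ≤ c + π) : ∫ x in (0 : ℝ)..1, sin (D * x ^ 2 - c) ≤ 0 := by
  have hc0 : 0 < c := lt_of_lt_of_le (by positivity) h1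
  rcases le_total D c with h | h
  · have : 0 ≤ ∫ x in (0 : ℝ)..1, -sin (D * x ^ 2 - c) := by
      refine intervalIntegral.integral_nonneg zero_le_one fun x hx => ?_
      have : x ^ 2 ≤ 1 := by nlinarith [hx.1, hx.2]
      refine neg_nonneg.2 (sin_nonpos_of_nonpos_of_neg_pi_le ?_ ?_)
      · nlinarith
      · nlinarith [mul_nonneg hD (sq_nonneg x)]
    rw [intervalIntegral.integral_neg] at this
    linarith
  · have hD0 : 0 < D := hc0.trans_le h
    set r := √(c / D) with hr
    have hr0 : 0 < r := sqrt_pos.2 (by positivity)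
    have hr2 : D * r ^ 2 = c := by
      rw [hr, sq_sqrt (by positivity)]; field_simp
    have hr1 : r ≤ 1 := by
      exact sqrt_le_one.2 ((div_le_one hD0).2 h)
    have hI : ∀ a b : ℝ, IntervalIntegrable (fun x => sin (D * x ^ 2 - c)) volume a b :=
      fun a b => Continuous.intervalIntegrable (by fun_prop) _ _
    rw [← integral_add_adjacent_intervals (hI 0 r) (hI r 1)]
    have hleft : ∫ x in (0 : ℝ)..r, sin (D * x ^ 2 - c) =
        -(r * ∫ x in (0 : ℝ)..1, sin (c - c * x ^ 2)) := by
      have h3 := smul_integral_comp_mul_left (a := 0) (b := 1) (fun x => sin (D * x ^ 2 - c)) r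
      simp only [smul_eq_mul, mul_zero, mul_one] at h3
      rw [← h3, ← mul_neg, ← intervalIntegral.integral_neg]
      congr 2
      ext x
      rw [← sin_neg, ← hr2]
      congr 1
      ring
    have hright : ∫ x in r..1, sin (D * x ^ 2 - c) ≤ 1 / (D * r) := by
      have hderiv : ∀ x ∈ uIcc r 1, HasDerivAt (fun x => -cos (D * x ^ 2 + 0 * x + -c) / (2 * D * r))
          (sin (D * x ^ 2 + 0 * x + -c) * (2 * D * x + 0) / (2 * D * r)) x := by
        intro x _
        refine (((hasDerivAt_quadratic D 0 (-c) x).cos).neg.div_const (2 * D * r)).congr_deriv ?_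
        ring
      have h3 := integral_eq_sub_of_hasDerivAt hderiv
        (Continuous.intervalIntegrable (by fun_prop) _ _)
      have h4 : ∫ x in r..1, sin (D * x ^ 2 - c) ≤
          ∫ x in r..1, sin (D * x ^ 2 + 0 * x + -c) * (2 * D * x + 0) / (2 * D * r) := by
        refine integral_mono_on hr1 (hI r 1) (Continuous.intervalIntegrable (by fun_prop) _ _)
          fun x hx => ?_
        have hx0 : 0 < x := hr0.trans_le hx.1
        have h5 : 0 ≤ sin (D * x ^ 2 - c) := by
          have h6 : r ^ 2 ≤ x ^ 2 := pow_le_pow_left₀ hr0.le hx.1 2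
          have h7 : x ^ 2 ≤ 1 := by nlinarith [hx.2]
          exact sin_nonneg_of_nonneg_of_le_pi (by nlinarith) (by nlinarith)
        have h8 : D * x ^ 2 + 0 * x + -c = D * x ^ 2 - c := by ring
        rw [h8, le_div_iff₀ (by positivity), add_zero]
        refine mul_le_mul_of_nonneg_left ?_ h5
        exact mul_le_mul_of_nonneg_left hx.1 (by positivity)
      refine h4.trans ?_
      rw [h3, div_sub_div_same, div_le_div_iff₀ (by positivity) (by positivity)]
      have h9 : D * r ^ 2 + 0 * r + -c = 0 := by rw [hr2]; ring
      rw [h9, cos_zero]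
      have h10 := neg_one_le_cos (D * 1 ^ 2 + 0 * 1 + -c)
      have : 0 < D * r := by positivity
      nlinarith
    have hS := one_le_mul_integral_sin h1 h2
    set S := ∫ x in (0 : ℝ)..1, sin (c - c * x ^ 2)
    have h11 : 1 / (D * r) ≤ r * S := by
      rw [div_le_iff₀ (by positivity)]
      calc 1 ≤ c * S := hS
        _ = r * S * (D * r) := by rw [← hr2]; ring
    rw [hleft]
    linarith

/-! ### Derivative of `g` and the uniqueness principle -/

theorem g_eq (φ₀ φ₁ A : ℝ) :
    g φ₀ φ₁ A = ∫ t in (0 : ℝ)..1, sin (A * t ^ 2 + (φ₁ - φ₀ - A) * t + φ₀) := by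
  simp only [g, Y, delta]
  congr! 5
  ring

theorem h_eq (φ₀ φ₁ A : ℝ) :
    h φ₀ φ₁ A = ∫ t in (0 : ℝ)..1, cos (A * t ^ 2 + (φ₁ - φ₀ - A) * t + φ₀) := by
  simp only [h, X, delta]
  congr! 5
  ring

theorem hasDerivAt_g (φ₀ φ₁ A : ℝ) :
    HasDerivAt (g φ₀ φ₁)
      (-∫ t in (0 : ℝ)..1, t * (1 - t) * cos (A * t ^ 2 + (φ₁ - φ₀ - A) * t + φ₀)) A := by
  have hg : g φ₀ φ₁ = fun A => ∫ t in (0 : ℝ)..1, sin (A * t ^ 2 + (φ₁ - φ₀ - A) * t + φ₀) :=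
    funext (g_eq φ₀ φ₁)
  rw [hg, ← intervalIntegral.integral_neg]
  refine (intervalIntegral.hasDerivAt_integral_of_dominated_loc_of_deriv_le
    (F := fun A t => sin (A * t ^ 2 + (φ₁ - φ₀ - A) * t + φ₀))
    (F' := fun A t => -(t * (1 - t) * cos (A * t ^ 2 + (φ₁ - φ₀ - A) * t + φ₀)))
    (bound := fun _ => 1) univ_mem ?_ ?_ ?_ ?_ ?_ ?_).2
  · exact Eventually.of_forall fun x => Continuous.aestronglyMeasurable (by fun_prop)
  · exact Continuous.intervalIntegrable (by fun_prop) _ _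
  · exact Continuous.aestronglyMeasurable (by fun_prop)
  · refine Eventually.of_forall fun t ht x _ => ?_
    rw [uIoc_of_le zero_le_one] at ht
    rw [norm_neg, norm_mul, norm_eq_abs, norm_eq_abs,
      abs_of_nonneg (mul_nonneg ht.1.le (sub_nonneg.2 ht.2))]
    refine mul_le_one₀ ?_ (abs_nonneg _) (abs_cos_le_one _)
    nlinarith [ht.1, ht.2]
  · exact intervalIntegrable_const
  · refine Eventually.of_forall fun t _ x _ => ?_
    have h1 : HasDerivAt (fun A : ℝ => A * t ^ 2 + (φ₁ - φ₀ - A) * t + φ₀) (t ^ 2 - t) x := by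
      refine ((((hasDerivAt_id x).mul_const (t ^ 2)).add
        (((hasDerivAt_id x).const_sub (φ₁ - φ₀)).mul_const t)).add_const φ₀).congr_deriv ?_
      ring
    refine h1.sin.congr_deriv ?_
    ring

/-- A differentiable function whose derivative is negative at each of its zeros in an interval has
at most one zero there. -/
theorem eq_of_deriv_neg_at_zeros {f f' : ℝ → ℝ} {a b x y : ℝ}
    (hf : ∀ t, HasDerivAt f (f' t) t) (hneg : ∀ t ∈ Icc a b, f t = 0 → f' t < 0)
    (hx : x ∈ Icc a b) (hy : y ∈ Icc a b) (hfx : f x = 0) (hfy : f y = 0) : x = y := by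
  have hcont : Continuous f := continuous_iff_continuousAt.2 fun t => (hf t).continuousAt
  have key : ∀ x y, x ∈ Icc a b → y ∈ Icc a b → f x = 0 → f y = 0 → ¬ x < y := by
    intro x y hx hy hfx hfy hxy
    have hright : ∀ᶠ t in 𝓝[>] x, f t < 0 := by
      have h1 := (hasDerivAt_iff_tendsto_slope.1 (hf x)).eventually_lt_const (hneg x hx hfx)
      have h2 := h1.filter_mono (nhdsWithin_mono x fun t (ht : x < t) => ht.ne')
      filter_upwards [h2, self_mem_nhdsWithin] with t ht htx
      rw [slope_def_field, hfx, sub_zero, div_neg_iff] at ht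
      rcases ht with h | h
      · exact absurd (sub_pos.2 htx) h.2.not_gt
      · exact h.1
    obtain ⟨x', hx'neg, hx'⟩ := (hright.and (Ioo_mem_nhdsGT hxy)).exists
    -- Just left of its first zero after `x'`, `f` would be positive, while `f x' < 0`; this forces
    -- a still earlier zero.
    set Z := Icc x' y ∩ f ⁻¹' {0} with hZ
    have hZc : IsCompact Z := isCompact_Icc.inter_right (isClosed_singleton.preimage hcont)
    obtain ⟨z, hzZ, hzmin⟩ := hZc.exists_isLeast ⟨y, ⟨hx'.2.le, le_rfl⟩, hfy⟩
    have hfz : f z = 0 := hzZ.2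
    have hx'z : x' < z := lt_of_le_of_ne hzZ.1.1 fun e => by rw [e, hfz] at hx'neg; exact hx'neg.false
    have hzab : z ∈ Icc a b :=
      ⟨hx.1.trans (hx'.1.le.trans hzZ.1.1), hzZ.1.2.trans hy.2⟩
    have hleft : ∀ᶠ t in 𝓝[<] z, 0 < f t := by
      have h1 := (hasDerivAt_iff_tendsto_slope.1 (hf z)).eventually_lt_const (hneg z hzab hfz)
      have h2 := h1.filter_mono (nhdsWithin_mono z fun t (ht : t < z) => ht.ne)
      filter_upwards [h2, self_mem_nhdsWithin] with t ht htz
      rw [slope_def_field, hfz, sub_zero, div_neg_iff] at ht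
      rcases ht with h | h
      · exact h.1
      · exact absurd (sub_neg.2 htz) h.2.not_gt
    obtain ⟨w, hwpos, hw⟩ := (hleft.and (Ioo_mem_nhdsLT hx'z)).exists
    obtain ⟨v, hv, hfv⟩ : (0 : ℝ) ∈ f '' Ioo x' w :=
      intermediate_value_Ioo hw.1.le hcont.continuousOn ⟨hx'neg, hwpos⟩
    have := hzmin ⟨⟨hv.1.le, (hv.2.trans hw.2).le.trans hzZ.1.2⟩, hfv⟩
    exact absurd (hv.2.trans hw.2) this.not_gt
  exact le_antisymm (not_lt.1 (key y x hy hx hfy hfx)) (not_lt.1 (key x y hx hy hfx hfy))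

/-! ### Positivity for monotone phases and for interior vertices -/

theorem integral_cos_pos_of_increasing {A B φ : ℝ} (hA : 0 ≤ A) (hB : 0 ≤ B)
    (hφ : φ < 0) (hφ' : -π < φ) (h1 : -φ ≤ A + B + φ) (h1' : A + B + φ ≤ π)
    (hs : ∫ t in (0 : ℝ)..1, sin (A * t ^ 2 + B * t + φ) = 0) :
    0 < ∫ t in (0 : ℝ)..1, cos (A * t ^ 2 + B * t + φ) := by
  -- `α` is midway between the initial phase and the mean of the extreme phases, each at distance
  -- `(A + B) / 4 < π / 2`. Since `∫ sin f = 0`, the rotated integral is `cos α * ∫ cos f`.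
  have hα := integral_cos_sub_pos (φ := φ) (α := φ + (A + B) / 4) hA hB (by linarith)
    (by linarith) (by linarith) (by linarith)
  simp only [cos_sub] at hα
  rw [intervalIntegral.integral_add (Continuous.intervalIntegrable (by fun_prop) _ _)
    (Continuous.intervalIntegrable (by fun_prop) _ _), intervalIntegral.integral_mul_const,
    intervalIntegral.integral_mul_const, hs, zero_mul, add_zero] at hα
  have hc : 0 < cos (φ + (A + B) / 4) := cos_pos_of_mem_Ioo ⟨by linarith, by linarith⟩
  exact pos_of_mul_pos_left hα hc.le

/-- The weight is symmetric under `t ↦ 1 - t`, so the part left of the vertex is a reflected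
instance of the right one. -/
theorem integral_mul_cos_pos_of_vertex_mem {A m s : ℝ} (hA : 0 < A) (hm : -(π / 2) ≤ m)
    (hm0 : m ≤ 0) (hs0 : 0 < s) (hs1 : s < 1) (h0π : A * s ^ 2 + m ≤ π)
    (h1π : A * (1 - s) ^ 2 + m ≤ π) :
    0 < ∫ t in (0 : ℝ)..1, t * (1 - t) * cos (A * (t - s) ^ 2 + m) := by
  have h1 := integral_mul_cos_pos_of_vertex hA hm hm0 hs0.le hs1 h1π
  have h2 := integral_mul_cos_pos_of_vertex (s := 1 - s) hA hm hm0 (by linarith) (by linarith)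
    (by simpa using h0π)
  have h3 := intervalIntegral.integral_comp_sub_left (a := 1 - s) (b := 1)
    (fun t => t * (1 - t) * cos (A * (t - s) ^ 2 + m)) 1
  rw [sub_self, sub_sub_cancel] at h3
  rw [← integral_add_adjacent_intervals (b := s)
    (Continuous.intervalIntegrable (by fun_prop) _ _)
    (Continuous.intervalIntegrable (by fun_prop) _ _), ← h3]
  refine add_pos (h2.trans_eq ?_) h1
  congr 1
  ext t
  rw [show (1 - t - s) ^ 2 = (t - (1 - s)) ^ 2 by ring]
  ring

theorem integral_cos_pos_of_vertex_mem {A m s : ℝ} (hA : 0 < A) (hm : -(π / 2) ≤ m)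
    (hm0 : m < 0) (hs0 : 0 < s) (hs1 : s < 1) (h0π : A * s ^ 2 + m ≤ π)
    (h1π : A * (1 - s) ^ 2 + m ≤ π) :
    0 < ∫ t in (0 : ℝ)..1, cos (A * (t - s) ^ 2 + m) := by
  have hhalf : ∀ D : ℝ, 0 < D → D + m ≤ π → 0 < ∫ x in (0 : ℝ)..1, cos (D * x ^ 2 + m) := by
    intro D hD hDm
    have := integral_cos_sub_pos (A := D) (B := 0) (φ := m) (α := 0) hD.le le_rfl (by linarith)
      (by linarith) (by linarith) (by linarith)
    simpa using this
  rw [integral_comp_vertex (F := fun y => cos (y + m)) (by fun_prop)]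
  have h1 : 0 < 1 - s := sub_pos.2 hs1
  exact add_pos (mul_pos hs0 (hhalf _ (by positivity) h0π))
    (mul_pos h1 (hhalf _ (by positivity) h1π))

/-! ### The vertex of the phase and `Amax` -/

theorem vertex_form {A φ₀ φ₁ : ℝ} (hA : 0 < A) (t : ℝ) :
    A * t ^ 2 + (φ₁ - φ₀ - A) * t + φ₀ =
      A * (t - (A - (φ₁ - φ₀)) / (2 * A)) ^ 2 +
        (φ₀ - A * ((A - (φ₁ - φ₀)) / (2 * A)) ^ 2) := by
  field_simp
  ring

/-- For `δ < A ≤ Amax`, the minimum of the phase is at least `-π/2`. -/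
theorem sq_le_of_delta_lt_of_le_Amax {φ₀ φ₁ A : ℝ} (h₀ : φ₀ ≤ φ₁) (hA : φ₁ - φ₀ < A)
    (hAm : A ≤ Amax φ₀ φ₁) :
    -(π / 2) < φ₀ ∧ (A - (φ₁ - φ₀)) ^ 2 ≤ 4 * A * (π / 2 + φ₀) := by
  have hpos : -(π / 2) < φ₀ := by
    by_contra hcon
    -- With `θ_max = 0` the second summand vanishes whatever the square root is, so `Amax = δ`.
    have : thetaMax φ₀ = 0 := max_eq_left (by linarith)
    simp only [Amax, this, delta] at hAm
    linarith
  refine ⟨hpos, ?_⟩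
  have hθ : thetaMax φ₀ = π / 2 + φ₀ := max_eq_right (by linarith)
  rw [Amax, hθ, delta] at hAm
  set θ := π / 2 + φ₀
  have hθ0 : 0 < θ := by simp only [θ]; linarith
  have hδ : 0 ≤ φ₁ - φ₀ := sub_nonneg.2 h₀
  set δ := φ₁ - φ₀
  have hr : √(1 + δ / θ) ^ 2 = 1 + δ / θ := sq_sqrt (by positivity)
  have hr1 : 1 ≤ √(1 + δ / θ) := one_le_sqrt.2 (by linarith [div_nonneg hδ hθ0.le])
  set r := √(1 + δ / θ)
  have hr2 : (θ * r) ^ 2 = θ ^ 2 + δ * θ := by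
    rw [mul_pow, hr]; field_simp
  -- The claim is equivalent to `(A - δ - 2θ)² ≤ 4 (θ² + δθ) = (2θr)²`.
  have h1 : A - δ - 2 * θ ≤ 2 * (θ * r) := by linarith
  have h2 : -(2 * (θ * r)) ≤ A - δ - 2 * θ := by nlinarith
  have h3 := sq_le_sq' h2 h1
  nlinarith

/-- For `-π/2 < φ₀`, the minimum of the phase at `A = Amax` is `-π/2`. -/
theorem Amax_vertex {φ₀ φ₁ : ℝ} (h₀ : φ₀ ≤ φ₁) (hφ : -(π / 2) < φ₀) :
    φ₁ - φ₀ < Amax φ₀ φ₁ ∧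
      (Amax φ₀ φ₁ - (φ₁ - φ₀)) ^ 2 = 4 * Amax φ₀ φ₁ * (π / 2 + φ₀) := by
  have hθ : thetaMax φ₀ = π / 2 + φ₀ := max_eq_right (by linarith)
  rw [Amax, hθ, delta]
  set θ := π / 2 + φ₀
  have hθ0 : 0 < θ := by simp only [θ]; linarith
  have hδ : 0 ≤ φ₁ - φ₀ := sub_nonneg.2 h₀
  set δ := φ₁ - φ₀
  have hr : √(1 + δ / θ) ^ 2 = 1 + δ / θ := sq_sqrt (by positivity)
  set r := √(1 + δ / θ)
  have hr0 : 0 ≤ r := sqrt_nonneg _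
  have hr2 : (θ * r) ^ 2 = θ ^ 2 + δ * θ := by
    rw [mul_pow, hr]; field_simp
  refine ⟨?_, ?_⟩
  · have : 0 < 2 * θ * (1 + r) := by positivity
    linarith
  · nlinarith

/-! ### Roots and end values of `g` -/

/-- At a root of `g` in `[0, Amax]` the derivative of `g` is negative and `h` is positive. -/
theorem pos_at_root {φ₀ φ₁ A : ℝ} (h₀ : |φ₀| ≤ φ₁) (h₁ : φ₁ ≤ π)
    (hne : ¬ (|φ₀| = π ∧ φ₁ = π)) (hA : A ∈ Icc 0 (Amax φ₀ φ₁)) (hg : g φ₀ φ₁ A = 0) :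
    0 < (∫ t in (0 : ℝ)..1, t * (1 - t) * cos (A * t ^ 2 + (φ₁ - φ₀ - A) * t + φ₀)) ∧
      0 < h φ₀ φ₁ A := by
  obtain ⟨hlo, hhi⟩ := abs_le.1 h₀
  have hπ := pi_pos
  have hgt : -π < φ₀ := by
    refine lt_of_le_of_ne (by linarith) fun e => hne ?_
    have : φ₁ = π := by linarith
    refine ⟨?_, this⟩
    rw [← e, abs_neg, abs_of_pos hπ]
  rw [g_eq] at hg
  rw [h_eq]
  have hA0 := hA.1
  have hlt : ∀ t ∈ Ioo (0 : ℝ) 1, 0 < A ∨ φ₀ < φ₁ →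
      A * t ^ 2 + (φ₁ - φ₀ - A) * t + φ₀ < π := by
    intro t ht hor
    have h2 : 0 < t * (1 - t) := mul_pos ht.1 (sub_pos.2 ht.2)
    have h3 : 0 < 1 - t := sub_pos.2 ht.2
    rcases hor with h | h
    · nlinarith [mul_pos h h2]
    · nlinarith [mul_nonneg hA0 h2.le, mul_pos (sub_pos.2 h) h3]
  rcases le_or_gt A (φ₁ - φ₀) with hle | hgtA
  · rcases le_or_gt 0 φ₀ with hφ | hφ
    · rcases hhi.eq_or_lt with e | hlt'
      · have hAz : A = 0 := le_antisymm (by linarith) hA0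
        subst hAz
        subst e
        simp only [sub_self, zero_mul, zero_add, intervalIntegral.integral_const, sub_zero,
          one_smul] at hg ⊢
        have hz : φ₀ = 0 := by
          by_contra hcon
          have hp : 0 < φ₀ := lt_of_le_of_ne hφ (Ne.symm hcon)
          have hlt2 : φ₀ < π := lt_of_le_of_ne h₁ fun e => hne ⟨by rw [abs_of_pos hp, e], e⟩
          exact (sin_pos_of_pos_of_lt_pi hp hlt2).ne' hg
        rw [hz]
        simp only [cos_zero, mul_one]
        refine ⟨?_, one_pos⟩
        exact intervalIntegral_pos_of_pos_on (Continuous.intervalIntegrable (by fun_prop) _ _)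
          (fun t ht => mul_pos ht.1 (sub_pos.2 ht.2)) one_pos
      · exfalso
        refine (intervalIntegral_pos_of_pos_on (Continuous.intervalIntegrable (by fun_prop) _ _)
          (fun t ht => sin_pos_of_pos_of_lt_pi ?_ (hlt t ht (Or.inr hlt'))) one_pos).ne' hg
        have h2 : 0 < 1 - t := sub_pos.2 ht.2
        have h3 := ht.1
        rcases hA0.eq_or_lt with e | h4
        · subst e
          nlinarith [mul_pos (sub_pos.2 hlt') h3]
        · have h5 : 0 < A * t ^ 2 := by positivity
          have h6 : 0 ≤ (φ₁ - φ₀ - A) * t := mul_nonneg (by linarith) h3.le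
          linarith
    · have hB : 0 ≤ φ₁ - φ₀ - A := by linarith
      refine ⟨?_, integral_cos_pos_of_increasing hA0 hB hφ hgt (by linarith) (by linarith) hg⟩
      rcases hB.eq_or_lt with e | hB'
      · rw [← e] at hg ⊢
        exact integral_mul_cos_pos_of_slope_zero (by linarith) hφ hgt hg
      · exact integral_mul_cos_pos_of_slope_pos hA0 hB' hφ hgt (by linarith) (by linarith) hg
  · have hApos : 0 < A := by linarith
    obtain ⟨hφ, hsq⟩ := sq_le_of_delta_lt_of_le_Amax hhi hgtA hA.2
    simp only [vertex_form hApos] at hg hlt ⊢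
    have hs0 : 0 < (A - (φ₁ - φ₀)) / (2 * A) := div_pos (by linarith) (by linarith)
    have hs1 : (A - (φ₁ - φ₀)) / (2 * A) < 1 := by rw [div_lt_one (by linarith)]; linarith
    have hm : A * ((A - (φ₁ - φ₀)) / (2 * A)) ^ 2 ≤ π / 2 + φ₀ := by
      rw [show A * ((A - (φ₁ - φ₀)) / (2 * A)) ^ 2 = (A - (φ₁ - φ₀)) ^ 2 / (4 * A) by
        field_simp; ring, div_le_iff₀ (by linarith)]
      linarith
    have hend : A * (1 - (A - (φ₁ - φ₀)) / (2 * A)) ^ 2 +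
        (φ₀ - A * ((A - (φ₁ - φ₀)) / (2 * A)) ^ 2) = φ₁ := by
      rw [← vertex_form hApos]; ring
    set s := (A - (φ₁ - φ₀)) / (2 * A)
    -- A nonnegative minimum would make the sine positive off the vertex, contradicting the root.
    have hm0 : φ₀ - A * s ^ 2 < 0 := by
      by_contra hcon
      refine (integral_pos_of_pos_off_point s zero_lt_one (by fun_prop) fun t ht hts => ?_).ne' hg
      have h2 : 0 < A * (t - s) ^ 2 := mul_pos hApos (sq_pos_of_ne_zero (sub_ne_zero.2 hts))
      exact sin_pos_of_pos_of_lt_pi (by linarith) (hlt t ht (Or.inl hApos))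
    exact ⟨integral_mul_cos_pos_of_vertex_mem hApos (by linarith) hm0.le hs0 hs1 (by linarith)
        (by linarith),
      integral_cos_pos_of_vertex_mem hApos (by linarith) hm0 hs0 hs1 (by linarith) (by linarith)⟩

/-- At `A = 0` the phase is linear and `δ g(0) = cos φ₀ - cos φ₁`; for `δ = 0` it is constant. -/
theorem g_zero_pos {φ₀ φ₁ : ℝ} (h₀ : |φ₀| ≤ φ₁) (h₁ : φ₁ ≤ π)
    (hne : ¬ (|φ₀| = π ∧ φ₁ = π)) (hsum : φ₀ + φ₁ ≠ 0) : 0 < g φ₀ φ₁ 0 := by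
  obtain ⟨hlo, hhi⟩ := abs_le.1 h₀
  rw [g_eq]
  rcases hhi.eq_or_lt with e | hlt
  · subst e
    have hp : 0 < φ₀ := lt_of_le_of_ne (by linarith) fun e => hsum (by rw [← e, add_zero])
    have hlt2 : φ₀ < π := lt_of_le_of_ne h₁ fun e => hne ⟨by rw [abs_of_pos hp, e], e⟩
    simpa using sin_pos_of_pos_of_lt_pi hp hlt2
  · have hδ := sub_pos.2 hlt
    have hderiv : ∀ t ∈ uIcc (0 : ℝ) 1,
        HasDerivAt (fun t => -cos (0 * t ^ 2 + (φ₁ - φ₀ - 0) * t + φ₀))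
          ((φ₁ - φ₀) * sin (0 * t ^ 2 + (φ₁ - φ₀ - 0) * t + φ₀)) t := by
      intro t _
      refine (hasDerivAt_quadratic 0 (φ₁ - φ₀ - 0) φ₀ t).cos.neg.congr_deriv ?_
      ring
    have h2 := integral_eq_sub_of_hasDerivAt hderiv
      (Continuous.intervalIntegrable (by fun_prop) _ _)
    rw [intervalIntegral.integral_const_mul] at h2
    refine pos_of_mul_pos_right ?_ hδ.le
    rw [h2]
    have habs : |φ₀| < φ₁ := by
      refine lt_of_le_of_ne h₀ fun e => ?_
      rcases abs_eq_abs.1 (e.trans (abs_of_nonneg ((abs_nonneg _).trans h₀)).symm) with h | h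
      · exact hlt.ne h
      · exact hsum (by rw [h]; ring)
    have h3 := cos_lt_cos_of_nonneg_of_le_pi (abs_nonneg φ₀) h₁ habs
    rw [cos_abs] at h3
    simp only [zero_mul, mul_one, mul_zero, sub_zero, zero_add, sub_add_cancel]
    linarith

/-- At `Amax` the phase is stationary at `0` if `φ₀ ≤ -π/2`, and otherwise has minimum `-π/2` at an
interior vertex. Either way each branch rescales to a pure square phase, with `c = -φ₀` or `c =
π/2`. -/
theorem g_Amax_nonpos {φ₀ φ₁ : ℝ} (h₀ : |φ₀| ≤ φ₁) (h₁ : φ₁ ≤ π) :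
    g φ₀ φ₁ (Amax φ₀ φ₁) ≤ 0 := by
  obtain ⟨hlo, hhi⟩ := abs_le.1 h₀
  have hπ := pi_pos
  rw [g_eq]
  rcases le_or_gt φ₀ (-(π / 2)) with hφ | hφ
  · have hθ : thetaMax φ₀ = 0 := max_eq_left (by linarith)
    have hAm : Amax φ₀ φ₁ = φ₁ - φ₀ := by simp [Amax, hθ, delta]
    rw [hAm]
    have := integral_sin_sub_nonpos (c := -φ₀) (D := φ₁ - φ₀) (by linarith) (by linarith)
      (by linarith) (by linarith)
    simpa using this
  · obtain ⟨h2, h3⟩ := Amax_vertex hhi hφ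
    set A := Amax φ₀ φ₁
    have hApos : 0 < A := by linarith
    simp only [vertex_form hApos]
    have hs0 : 0 < (A - (φ₁ - φ₀)) / (2 * A) := div_pos (by linarith) (by linarith)
    have hs1 : (A - (φ₁ - φ₀)) / (2 * A) < 1 := by rw [div_lt_one (by linarith)]; linarith
    have hm : A * ((A - (φ₁ - φ₀)) / (2 * A)) ^ 2 = π / 2 + φ₀ := by
      rw [show A * ((A - (φ₁ - φ₀)) / (2 * A)) ^ 2 = (A - (φ₁ - φ₀)) ^ 2 / (4 * A) by
        field_simp; ring, h3]
      field_simp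
    have hend : A * (1 - (A - (φ₁ - φ₀)) / (2 * A)) ^ 2 +
        (φ₀ - A * ((A - (φ₁ - φ₀)) / (2 * A)) ^ 2) = φ₁ := by
      rw [← vertex_form hApos]; ring
    set s := (A - (φ₁ - φ₀)) / (2 * A)
    have hm' : φ₀ - A * s ^ 2 = -(π / 2) := by linarith
    rw [hm'] at hend ⊢
    have hhalf : ∀ D : ℝ, 0 ≤ D → D ≤ π / 2 + π →
        ∫ x in (0 : ℝ)..1, sin (D * x ^ 2 + -(π / 2)) ≤ 0 := fun D hD hD' =>
      integral_sin_sub_nonpos le_rfl (by linarith) hD hD'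
    rw [integral_comp_vertex (F := fun y => sin (y + -(π / 2))) (by fun_prop)]
    have h4 := mul_nonpos_of_nonneg_of_nonpos hs0.le
      (hhalf (A * s ^ 2) (by positivity) (by linarith))
    have h5 := mul_nonpos_of_nonneg_of_nonpos (sub_pos.2 hs1).le
      (hhalf (A * (1 - s) ^ 2) (by positivity) (by linarith))
    linarith

theorem Amax_nonneg {φ₀ φ₁ : ℝ} (h₀ : φ₀ ≤ φ₁) : 0 ≤ Amax φ₀ φ₁ := by
  have h1 : 0 ≤ thetaMax φ₀ := le_max_left _ _
  have h2 : 0 ≤ delta φ₀ φ₁ := sub_nonneg.2 h₀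
  rw [Amax]
  positivity

/-- The linear phase is odd under `t ↦ 1 - t`. -/
theorem g_zero_of_add_eq_zero {φ₀ φ₁ : ℝ} (hsum : φ₀ + φ₁ = 0) : g φ₀ φ₁ 0 = 0 := by
  rw [g_eq]
  have h1 := intervalIntegral.integral_comp_sub_left (a := 0) (b := 1)
    (fun t => sin (0 * t ^ 2 + (φ₁ - φ₀ - 0) * t + φ₀)) 1
  have h2 : φ₁ = -φ₀ := by linarith
  subst h2
  have h3 : ∀ t : ℝ, sin (0 * (1 - t) ^ 2 + (-φ₀ - φ₀ - 0) * (1 - t) + φ₀) =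
      -sin (0 * t ^ 2 + (-φ₀ - φ₀ - 0) * t + φ₀) := by
    intro t
    rw [← sin_neg]
    congr 1
    ring
  simp only [h3, intervalIntegral.integral_neg] at h1
  simp only [sub_self, sub_zero] at h1 ⊢
  linarith

end Clothoid

/-! ### The main theorem -/

theorem mainTheorem1 (φ₀ φ₁ : ℝ) (h₀ : |φ₀| ≤ φ₁) (h₁ : φ₁ ≤ Real.pi)
    (hne : ¬ (|φ₀| = Real.pi ∧ φ₁ = Real.pi)) :
    (φ₀ + φ₁ ≠ 0 →
      ∃! A : ℝ, A ∈ Set.Ioc 0 (Clothoid.Amax φ₀ φ₁) ∧ Clothoid.g φ₀ φ₁ A = 0) ∧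
    (φ₀ + φ₁ = 0 →
      ∀ A ∈ Set.Icc 0 (Clothoid.Amax φ₀ φ₁), Clothoid.g φ₀ φ₁ A = 0 ↔ A = 0) ∧
    (∀ A ∈ Set.Icc 0 (Clothoid.Amax φ₀ φ₁), Clothoid.g φ₀ φ₁ A = 0 →
      0 < Clothoid.h φ₀ φ₁ A ∧
      ∀ Δx Δy : ℝ, (Δx, Δy) ≠ (0, 0) → 0 < Clothoid.length φ₀ φ₁ Δx Δy A) := by
  have hAm := Clothoid.Amax_nonneg ((le_abs_self φ₀).trans h₀)
  have huniq : ∀ x ∈ Set.Icc 0 (Clothoid.Amax φ₀ φ₁), ∀ y ∈ Set.Icc 0 (Clothoid.Amax φ₀ φ₁),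
      Clothoid.g φ₀ φ₁ x = 0 → Clothoid.g φ₀ φ₁ y = 0 → x = y := fun x hx y hy hgx hgy =>
    Clothoid.eq_of_deriv_neg_at_zeros (Clothoid.hasDerivAt_g φ₀ φ₁)
      (fun A hA hg => neg_neg_of_pos (Clothoid.pos_at_root h₀ h₁ hne hA hg).1) hx hy hgx hgy
  refine ⟨fun hsum => ?_, fun hsum A hA => ⟨fun hg => ?_, ?_⟩, fun A hA hg => ?_⟩
  · have hpos := Clothoid.g_zero_pos h₀ h₁ hne hsum
    have hcont : Continuous (Clothoid.g φ₀ φ₁) :=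
      continuous_iff_continuousAt.2 fun A => (Clothoid.hasDerivAt_g φ₀ φ₁ A).continuousAt
    obtain ⟨A, hA, hg⟩ := intermediate_value_Icc' hAm hcont.continuousOn
      ⟨Clothoid.g_Amax_nonpos h₀ h₁, hpos.le⟩
    refine ⟨A, ⟨⟨lt_of_le_of_ne hA.1 fun e => ?_, hA.2⟩, hg⟩, fun y hy =>
      huniq y (Set.Ioc_subset_Icc_self hy.1) A hA hy.2 hg⟩
    rw [← e] at hg
    exact hpos.ne' hg
  · exact huniq A hA 0 ⟨le_rfl, hAm⟩ hg (Clothoid.g_zero_of_add_eq_zero hsum)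
  · rintro rfl
    exact Clothoid.g_zero_of_add_eq_zero hsum
  · have hh := (Clothoid.pos_at_root h₀ h₁ hne hA hg).2
    refine ⟨hh, fun Δx Δy hΔ => div_pos (Real.sqrt_pos.2 ?_) hh⟩
    by_cases hx : Δx = 0
    · have hy : Δy ≠ 0 := fun hy => hΔ (by rw [hx, hy])
      positivity
    · positivity
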